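/- **Theorem (Noncommutative Ottaviani inequality).** Let $\mathfrak M$ be a von Neumann algebra on a Hilbert space, with a normal faithful tracial state $\tau$. For a self-adjoint $x\in\mathfrak M$ and a Borel set $B\subseteq\mathbb R$ let $e_B(x)\in\mathfrak M$ be the spectral projection of $x$ for $B$, and write $W^*(S)$ for the von Neumann algebra generated by $S\subseteq\mathfrak M$. Let $n\ge 1$ and let $x_1,\dots,x_n\in\mathfrak M$ be self-adjoint and weakly fully independent, that is, for every $1<j\le n$, $$\tau(ab)=\tau(a)\tau(b)\qquad\text{for all } a\in W^*(x_1,\dots,x_{j-1}),\ b\in W^*(x_j,\dots,x_n).$$ Let $s_k=x_1+\dots+x_k$ and suppose that $s_ks_n=s_ns_k$ for $k=1,\dots,n$. Let $\lambda>0$ and put $$M_\lambda=\frac{1}{\min_{1\le k\le n}\tau\bigl(e_{(-\infty,\lambda/2]}(|s_n-s_k|)\bigr)}\in[1,\infty]\qquad(\text{with }1/0=\infty).$$ Then there is a projection $p\in\mathfrak M$ such that $$\max_{1\le k\le n}\frac1{2^{k-1}}\,\tau\bigl(e_{(2\lambda,\infty)}(|s_k|)\bigr)\ \le\ \tau(p)\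 \le\ M_\lambda\,\tau\bigl(e_{(\lambda/2,\infty)}(|s_n|)\bigr),$$ where the right-hand side is read as $\infty$ (so that the upper bound is void) if $M_\lambda=\infty$. -/

import Mathlib

open MeasureTheory Filter Topology
open scoped ComplexOrder ENNReal CompactlySupported

namespace SpectralCalculus

variable {H : Type*} [NormedAddCommGroup H] [InnerProductSpace ℂ H] [CompleteSpace H]

lemma inner_cfc_eq_re (x : H →L[ℂ] H) (f : ℝ → ℝ) (ξ : H) :
    inner ℂ ξ (cfc f x ξ) = ((inner ℂ ξ (cfc f x ξ)).re : ℂ) := by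
  have h : IsSelfAdjoint (cfc f x) := cfc_predicate f x
  have h2 : ((inner ℂ (cfc f x ξ) ξ).re : ℂ) = inner ℂ (cfc f x ξ) ξ :=
    (ContinuousLinearMap.isSelfAdjoint_iff_isSymmetric.mp h).coe_re_inner_apply_self ξ
  have h3 : inner ℂ (cfc f x ξ) ξ = inner ℂ ξ (cfc f x ξ) :=
    (ContinuousLinearMap.isSelfAdjoint_iff_isSymmetric.mp h) ξ ξ
  rw [← h3, h2]

lemma re_inner_cfc_nonneg (x : H →L[ℂ] H) (f : ℝ → ℝ) (hf : ∀ t, 0 ≤ f t) (ξ : H) :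
    0 ≤ (inner ℂ ξ (cfc f x ξ)).re := by
  have h : (0 : H →L[ℂ] H) ≤ cfc f x := cfc_nonneg fun t _ => hf t
  rw [ContinuousLinearMap.nonneg_iff_isPositive] at h
  exact h.re_inner_nonneg_right ξ

/-- The positive functional `f ↦ ⟨ξ, f(x) ξ⟩` on `C_c(ℝ)`, where `f(x)` is given by the
continuous functional calculus. -/
noncomputable def vectorFunctional (x : H →L[ℂ] H) (ξ : H) : C_c(ℝ, ℝ) →ₚ[ℝ] ℝ :=
  PositiveLinearMap.mk₀
    { toFun := fun f => (inner ℂ ξ (cfc f x ξ)).re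
      map_add' := fun f g => by
        have : cfc (⇑(f + g)) x = cfc f x + cfc g x :=
          cfc_add x f g f.continuous.continuousOn g.continuous.continuousOn
        rw [this]; simp [inner_add_right]
      map_smul' := fun c f => by
        have : cfc (⇑(c • f)) x = c • cfc f x := cfc_smul c f x f.continuous.continuousOn
        rw [this]; simp [inner_smul_right_eq_smul] }
    fun f hf => re_inner_cfc_nonneg x f (fun t => hf t) ξ

/-- The spectral measure `μ_ξ` of `x` at the vector `ξ`: the Borel measure on `ℝ` that the
Riesz representation theorem associates with `f ↦ ⟨ξ, f(x) ξ⟩`. -/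
noncomputable def vectorMeasure (x : H →L[ℂ] H) (ξ : H) : Measure ℝ :=
  RealRMK.rieszMeasure (vectorFunctional x ξ)

instance (x : H →L[ℂ] H) (ξ : H) : (vectorMeasure x ξ).Regular :=
  RealRMK.regular_rieszMeasure _

lemma integral_vectorMeasure (x : H →L[ℂ] H) (ξ : H) (f : C_c(ℝ, ℝ)) :
    ∫ t, f t ∂(vectorMeasure x ξ) = (inner ℂ ξ (cfc f x ξ)).re :=
  RealRMK.integral_rieszMeasure (vectorFunctional x ξ) f

lemma norm_cfc_le_one (x : H →L[ℂ] H) (f : ℝ → ℝ) (hf : ∀ t, 0 ≤ f t ∧ f t ≤ 1) :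
    ‖cfc f x‖ ≤ 1 :=
  norm_cfc_le zero_le_one fun t _ => by
    rw [Real.norm_eq_abs, abs_of_nonneg (hf t).1]; exact (hf t).2

lemma norm_inner_cfc_le (x : H →L[ℂ] H) (f : ℝ → ℝ) (hf : ∀ t, 0 ≤ f t ∧ f t ≤ 1) (ξ η : H) :
    ‖inner ℂ ξ (cfc f x η)‖ ≤ ‖ξ‖ * ‖η‖ := by
  refine (norm_inner_le_norm _ _).trans ?_
  gcongr
  simpa using (cfc f x).le_of_opNorm_le (norm_cfc_le_one x f hf) η

instance (x : H →L[ℂ] H) (ξ : H) : IsFiniteMeasure (vectorMeasure x ξ) := by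
  constructor
  refine lt_of_le_of_lt ?_ (ENNReal.ofReal_lt_top (r := ‖ξ‖ * ‖ξ‖))
  rw [isOpen_univ.measure_eq_iSup_isCompact]
  refine iSup_le fun K => iSup_le fun _ => iSup_le fun hK => ?_
  obtain ⟨f, hf1, -, hfc, hf⟩ := exists_continuous_one_zero_of_isCompact hK isClosed_empty
    (Set.disjoint_empty K)
  refine (RealRMK.rieszMeasure_le_of_eq_one (vectorFunctional x ξ) (f := ⟨f, hfc⟩)
    (fun t => (hf t).1) hK (fun t ht => hf1 ht)).trans (ENNReal.ofReal_le_ofReal ?_)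
  exact (Complex.re_le_norm _).trans (norm_inner_cfc_le x f hf ξ ξ)

/-- Indicators of Borel sets are approximated in mean by continuous compactly supported
functions with values in `[0, 1]`, for finitely many of the measures `μ_ξ` at once. -/
lemma exists_approx {ι : Type*} [Fintype ι] (x : H →L[ℂ] H) (v : ι → H) {B : Set ℝ}
    (hB : MeasurableSet B) {ε : ℝ} (hε : 0 < ε) :
    ∃ f : C_c(ℝ, ℝ), (∀ t, 0 ≤ f t ∧ f t ≤ 1) ∧ ∀ i,
      ∫ t, |B.indicator (fun _ => (1 : ℝ)) t - f t| ∂(vectorMeasure x (v i)) ≤ ε := by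
  set ν : Measure ℝ := ∑ i, vectorMeasure x (v i) with hν
  have hint : Integrable (B.indicator fun _ => (1 : ℝ)) ν :=
    (integrable_const (1 : ℝ)).indicator hB
  obtain ⟨g, hgc, hg, hgcont, hgi⟩ := hint.exists_hasCompactSupport_integral_sub_le hε
  let f : C_c(ℝ, ℝ) := ⟨⟨fun t => max 0 (min 1 (g t)), by fun_prop⟩, by
    refine hgc.mono' ?_
    intro t ht
    refine subset_tsupport g ?_
    simp only [Function.mem_support, ContinuousMap.toFun_eq_coe, ContinuousMap.coe_mk] at ht ⊢
    rintro h0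
    simp [h0] at ht⟩
  have hf : ∀ t, f t = max 0 (min 1 (g t)) := fun t => rfl
  refine ⟨f, fun t => by rw [hf]; simp, fun i => le_trans ?_ hg⟩
  have hle : vectorMeasure x (v i) ≤ ν := by
    rw [hν]
    exact Finset.single_le_sum (f := fun i => vectorMeasure x (v i)) (fun _ _ => Measure.zero_le _)
      (Finset.mem_univ i)
  calc ∫ t, |B.indicator (fun _ => (1 : ℝ)) t - f t| ∂(vectorMeasure x (v i))
      ≤ ∫ t, ‖B.indicator (fun _ => (1 : ℝ)) t - g t‖ ∂(vectorMeasure x (v i)) := by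
        refine integral_mono_of_nonneg (.of_forall fun t => abs_nonneg _)
          ((hint.sub hgi).mono_measure hle).norm (.of_forall fun t => ?_)
        simp only [hf, Real.norm_eq_abs]
        by_cases ht : t ∈ B
        · rw [Set.indicator_of_mem ht]
          rcases le_total 1 (g t) with h | h <;> rcases le_total 0 (g t) with h' | h' <;>
            simp [h, h'] <;> first | linarith | skip
          rw [abs_of_nonneg (by linarith)]; linarith
        · rw [Set.indicator_of_notMem ht]
          rcases le_total 1 (g t) with h | h <;> rcases le_total 0 (g t) with h' | h' <;>
            simp [h, h'] <;> first | linarith | skip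
          rw [abs_of_nonneg (by linarith)]; linarith
    _ ≤ ∫ t, ‖B.indicator (fun _ => (1 : ℝ)) t - g t‖ ∂ν :=
        integral_mono_measure hle (.of_forall fun t => norm_nonneg _) (hint.sub hgi).norm

lemma integrable_cc (x : H →L[ℂ] H) (ξ : H) (f : C_c(ℝ, ℝ)) :
    Integrable f (vectorMeasure x ξ) :=
  f.continuous.integrable_of_hasCompactSupport f.hasCompactSupport

lemma abs_measure_sub_le (x : H →L[ℂ] H) (ξ : H) {B : Set ℝ} (hB : MeasurableSet B)
    (f : C_c(ℝ, ℝ)) {ε : ℝ}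
    (h : ∫ t, |B.indicator (fun _ => (1 : ℝ)) t - f t| ∂(vectorMeasure x ξ) ≤ ε) :
    |(vectorMeasure x ξ).real B - (inner ℂ ξ (cfc f x ξ)).re| ≤ ε := by
  have h1 : (vectorMeasure x ξ).real B
      = ∫ t, B.indicator (fun _ => (1 : ℝ)) t ∂(vectorMeasure x ξ) := by
    rw [integral_indicator hB]; simp
  rw [h1, ← integral_vectorMeasure, ← integral_sub ((integrable_const (1 : ℝ)).indicator hB)
    (integrable_cc x ξ f)]
  exact (abs_integral_le_integral_abs).trans h

lemma tendsto_inner_cfc (x : H →L[ℂ] H) (ξ : H) {B : Set ℝ} (hB : MeasurableSet B)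
    (f : ℕ → C_c(ℝ, ℝ))
    (h : Tendsto (fun n => ∫ t, |B.indicator (fun _ => (1 : ℝ)) t - f n t| ∂(vectorMeasure x ξ))
      atTop (𝓝 0)) :
    Tendsto (fun n => inner ℂ ξ (cfc (f n) x ξ)) atTop
      (𝓝 (((vectorMeasure x ξ).real B : ℝ) : ℂ)) := by
  have : Tendsto (fun n => (inner ℂ ξ (cfc (f n) x ξ)).re) atTop
      (𝓝 ((vectorMeasure x ξ).real B)) := by
    rw [tendsto_iff_dist_tendsto_zero]
    refine squeeze_zero (fun _ => dist_nonneg) (fun n => ?_) h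
    rw [dist_comm, Real.dist_eq]
    exact abs_measure_sub_le x ξ hB (f n) le_rfl
  refine ((Complex.continuous_ofReal.tendsto _).comp this).congr fun n => ?_
  simp only [Function.comp_apply]
  rw [← inner_cfc_eq_re]

/-- The polarization of `ξ ↦ μ_ξ(B)`. -/
noncomputable def polar (x : H →L[ℂ] H) (B : Set ℝ) (ξ η : H) : ℂ :=
  (((vectorMeasure x (ξ + η)).real B - (vectorMeasure x (ξ - η)).real B : ℂ)
    - Complex.I * ((vectorMeasure x (ξ + Complex.I • η)).real B
      - (vectorMeasure x (ξ - Complex.I • η)).real B)) / 4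

lemma inner_polar (T : H →L[ℂ] H) (ξ η : H) :
    inner ℂ ξ (T η) = ((inner ℂ (ξ + η) (T (ξ + η)) - inner ℂ (ξ - η) (T (ξ - η)))
      - Complex.I * (inner ℂ (ξ + Complex.I • η) (T (ξ + Complex.I • η))
        - inner ℂ (ξ - Complex.I • η) (T (ξ - Complex.I • η)))) / 4 := by
  simp only [map_add, map_sub, map_smul, inner_add_left, inner_add_right, inner_sub_left,
    inner_sub_right, inner_smul_left, inner_smul_right, Complex.conj_I]
  ring_nf
  simp only [Complex.I_sq]
  ring

lemma exists_seq {ι : Type*} [Fintype ι] (x : H →L[ℂ] H) (ξ η : ι → H) {B : Set ℝ}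
    (hB : MeasurableSet B) :
    ∃ f : ℕ → C_c(ℝ, ℝ), (∀ n t, 0 ≤ f n t ∧ f n t ≤ 1) ∧ ∀ i,
      Tendsto (fun n => inner ℂ (ξ i) (cfc (f n) x (η i))) atTop (𝓝 (polar x B (ξ i) (η i))) ∧
      Tendsto (fun n => ∫ t, |B.indicator (fun _ => (1 : ℝ)) t - f n t| ∂(vectorMeasure x (η i)))
        atTop (𝓝 0) := by
  let v : ι × Fin 5 → H := fun p => ![ξ p.1 + η p.1, ξ p.1 - η p.1,
    ξ p.1 + Complex.I • η p.1, ξ p.1 - Complex.I • η p.1, η p.1] p.2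
  choose f hf1 hf2 using fun n : ℕ => exists_approx x v hB (Nat.one_div_pos_of_nat (α := ℝ) (n := n))
  have key (p) : Tendsto (fun n => inner ℂ (v p) (cfc (f n) x (v p))) atTop
      (𝓝 (((vectorMeasure x (v p)).real B : ℝ) : ℂ)) :=
    tendsto_inner_cfc x (v p) hB f <| squeeze_zero (fun _ => integral_nonneg fun _ => abs_nonneg _)
      (fun n => hf2 n p) tendsto_one_div_add_atTop_nhds_zero_nat
  refine ⟨f, hf1, fun i => ⟨?_, ?_⟩⟩
  · refine Tendsto.congr (fun n => (inner_polar (cfc (f n) x) (ξ i) (η i)).symm) ?_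
    exact (((key (i, 0)).sub (key (i, 1))).sub
      (((key (i, 2)).sub (key (i, 3))).const_mul Complex.I)).div_const 4
  · exact squeeze_zero (fun _ => integral_nonneg fun _ => abs_nonneg _)
      (fun n => hf2 n (i, 4)) tendsto_one_div_add_atTop_nhds_zero_nat

/-- There is a bounded operator with quadratic form `ξ ↦ μ_ξ(B)`. -/
lemma exists_operator (x : H →L[ℂ] H) {B : Set ℝ} (hB : MeasurableSet B) :
    ∃ T : H →L[ℂ] H, ∀ ξ, inner ℂ ξ (T ξ) = ((vectorMeasure x ξ).real B : ℂ) := by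
  let S : H →ₗ⋆[ℂ] H →ₗ[ℂ] ℂ := LinearMap.mk₂'ₛₗ _ _ (polar x B)
    (fun a b c => by
      obtain ⟨f, -, hf⟩ := exists_seq x ![a + b, a, b] ![c, c, c] hB
      refine tendsto_nhds_unique (hf 0).1 (((hf 1).1.add (hf 2).1).congr fun n => ?_)
      simp [inner_add_left])
    (fun z a c => by
      obtain ⟨f, -, hf⟩ := exists_seq x ![z • a, a] ![c, c] hB
      refine tendsto_nhds_unique (hf 0).1 (((hf 1).1.const_mul _).congr fun n => ?_)
      simp [inner_smul_left, mul_comm])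
    (fun a b c => by
      obtain ⟨f, -, hf⟩ := exists_seq x ![a, a, a] ![b + c, b, c] hB
      refine tendsto_nhds_unique (hf 0).1 (((hf 1).1.add (hf 2).1).congr fun n => ?_)
      simp [inner_add_right])
    (fun z a c => by
      obtain ⟨f, -, hf⟩ := exists_seq x ![a, a] ![z • c, c] hB
      refine tendsto_nhds_unique (hf 0).1 (((hf 1).1.const_mul _).congr fun n => ?_)
      simp [inner_smul_right])
  let S' : H →L⋆[ℂ] H →L[ℂ] ℂ := S.mkContinuous₂ 1 fun a b => by
    obtain ⟨f, hf1, hf⟩ := exists_seq x ![a] ![b] hB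
    rw [one_mul]
    exact le_of_tendsto (hf 0).1.norm (.of_forall fun n => norm_inner_cfc_le x (f n) (hf1 n) a b)
  refine ⟨ContinuousLinearMap.adjoint (InnerProductSpace.continuousLinearMapOfBilin S'),
    fun ξ => ?_⟩
  rw [ContinuousLinearMap.adjoint_inner_right, InnerProductSpace.continuousLinearMapOfBilin_apply]
  obtain ⟨f, -, hf⟩ := exists_seq x ![ξ] ![ξ] hB
  exact tendsto_nhds_unique (hf 0).1 (tendsto_inner_cfc x ξ hB f (hf 0).2)

open Classical in
/-- The spectral projection `e_B(x)` of the self-adjoint operator `x` for the Borel set `B ⊆ ℝ`: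
the operator with `⟨ξ, e_B(x) ξ⟩ = μ_ξ(B)` for every vector `ξ`. It is shown below that
`B ↦ e_B(x)` is the spectral measure of `x`. (If `B` is not a Borel set the value is `0`.) -/
noncomputable def spectralProjection (x : H →L[ℂ] H) (B : Set ℝ) : H →L[ℂ] H :=
  if hB : MeasurableSet B then (exists_operator x hB).choose else 0

lemma inner_spectralProjection (x : H →L[ℂ] H) {B : Set ℝ} (hB : MeasurableSet B) (ξ : H) :
    inner ℂ ξ (spectralProjection x B ξ) = ((vectorMeasure x ξ).real B : ℂ) := by
  rw [spectralProjection, dif_pos hB]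
  exact (exists_operator x hB).choose_spec ξ

lemma operator_ext {S T : H →L[ℂ] H} (h : ∀ ξ, inner ℂ ξ (S ξ) = inner ℂ ξ (T ξ)) : S = T := by
  have : (S : H →ₗ[ℂ] H) = T := by
    rw [← ext_inner_map]
    intro ξ
    have := congrArg (starRingEnd ℂ) (h ξ)
    rw [inner_conj_symm, inner_conj_symm] at this
    exact this
  exact ContinuousLinearMap.coe_injective this

lemma inner_spectralProjection_eq_polar (x : H →L[ℂ] H) {B : Set ℝ} (hB : MeasurableSet B)
    (ξ η : H) : inner ℂ ξ (spectralProjection x B η) = polar x B ξ η := by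
  rw [inner_polar, polar]
  simp only [inner_spectralProjection x hB]

lemma commute_spectralProjection {x y : H →L[ℂ] H} (h : Commute x y) (B : Set ℝ) :
    Commute (spectralProjection x B) y := by
  by_cases hB : MeasurableSet B
  swap
  · rw [spectralProjection, dif_neg hB]; exact Commute.zero_left _
  refine operator_ext fun ξ => ?_
  change inner ℂ ξ (spectralProjection x B (y ξ)) = inner ℂ ξ (y (spectralProjection x B ξ))
  rw [← ContinuousLinearMap.adjoint_inner_left y, inner_spectralProjection_eq_polar x hB,
    inner_spectralProjection_eq_polar x hB]
  obtain ⟨f, -, hf⟩ := exists_seq x ![ξ, ContinuousLinearMap.adjoint y ξ] ![y ξ, ξ] hB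
  refine tendsto_nhds_unique (hf 0).1 ((hf 1).1.congr fun n => ?_)
  have := congrArg (fun T : H →L[ℂ] H => T ξ) (h.cfc_real (f n)).eq
  simp only [ContinuousLinearMap.mul_apply] at this
  simp [this, ContinuousLinearMap.adjoint_inner_left]

lemma inner_cfc_cfc (x : H →L[ℂ] H) (f g : C_c(ℝ, ℝ)) (ξ : H) :
    inner ℂ (cfc f x ξ) (cfc g x ξ) = ((∫ t, f t * g t ∂(vectorMeasure x ξ) : ℝ) : ℂ) := by
  have h : IsSelfAdjoint (cfc f x) := cfc_predicate f x
  have h2 := (ContinuousLinearMap.isSelfAdjoint_iff_isSymmetric.mp h) ξ (cfc g x ξ)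
  have h3 : cfc (⇑(f * g)) x = cfc f x * cfc g x :=
    cfc_mul f g x f.continuous.continuousOn g.continuous.continuousOn
  have h4 := integral_vectorMeasure x ξ (f * g)
  rw [CompactlySupportedContinuousMap.coe_mul] at h4 h3
  simp only [Pi.mul_apply] at h4
  rw [h4, ← inner_cfc_eq_re, h3]
  exact h2

lemma norm_cfc_sub_sq_le (x : H →L[ℂ] H) (ξ : H) {B : Set ℝ} (hB : MeasurableSet B)
    (f g : C_c(ℝ, ℝ)) (hf : ∀ t, 0 ≤ f t ∧ f t ≤ 1) (hg : ∀ t, 0 ≤ g t ∧ g t ≤ 1) :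
    ‖cfc f x ξ - cfc g x ξ‖ ^ 2
      ≤ ∫ t, |B.indicator (fun _ => (1 : ℝ)) t - f t| ∂(vectorMeasure x ξ)
        + ∫ t, |B.indicator (fun _ => (1 : ℝ)) t - g t| ∂(vectorMeasure x ξ) := by
  have h1 : cfc (⇑(f - g)) x = cfc f x - cfc g x :=
    cfc_sub f g x f.continuous.continuousOn g.continuous.continuousOn
  have h2 := inner_cfc_cfc x (f - g) (f - g) ξ
  rw [h1, sub_apply, inner_self_eq_norm_sq_to_K] at h2
  have h3 : ‖cfc f x ξ - cfc g x ξ‖ ^ 2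
      = ∫ t, (f - g) t * (f - g) t ∂(vectorMeasure x ξ) := by
    exact Complex.ofReal_injective (by rw [← h2]; push_cast; rfl)
  have hint : Integrable (B.indicator fun _ => (1 : ℝ)) (vectorMeasure x ξ) :=
    (integrable_const (1 : ℝ)).indicator hB
  have hif := (hint.sub (integrable_cc x ξ f)).norm
  have hig := (hint.sub (integrable_cc x ξ g)).norm
  rw [h3]
  refine le_trans ?_ (integral_add hif hig).le
  refine integral_mono_of_nonneg (.of_forall fun t => mul_self_nonneg _) (hif.add hig)
    (.of_forall fun t => ?_)
  simp only [CompactlySupportedContinuousMap.sub_apply, Pi.sub_apply, Pi.add_apply,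
    Real.norm_eq_abs]
  set c := B.indicator (fun _ => (1 : ℝ)) t
  have h4 : |f t - g t| ≤ |c - f t| + |c - g t| := by
    have := abs_sub_le (f t) c (g t)
    rwa [abs_sub_comm (f t) c] at this
  have h5 : |f t - g t| ≤ 1 := by
    rw [abs_le]; constructor <;> linarith [(hf t).1, (hf t).2, (hg t).1, (hg t).2]
  rw [← abs_mul_abs_self]
  nlinarith [abs_nonneg (f t - g t)]

lemma tendsto_cfc_spectralProjection (x : H →L[ℂ] H) (ξ : H) {B : Set ℝ} (hB : MeasurableSet B)
    (f : ℕ → C_c(ℝ, ℝ)) (hf : ∀ n t, 0 ≤ f n t ∧ f n t ≤ 1)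
    (h : Tendsto (fun n => ∫ t, |B.indicator (fun _ => (1 : ℝ)) t - f n t| ∂(vectorMeasure x ξ))
      atTop (𝓝 0)) :
    Tendsto (fun n => cfc (f n) x ξ) atTop (𝓝 (spectralProjection x B ξ)) := by
  rw [tendsto_iff_norm_sub_tendsto_zero]
  have h' := h.sqrt
  rw [Real.sqrt_zero] at h'
  refine squeeze_zero (fun _ => norm_nonneg _) (fun n => ?_) h'
  set c := ∫ t, |B.indicator (fun _ => (1 : ℝ)) t - f n t| ∂(vectorMeasure x ξ) with hc
  set η := cfc (f n) x ξ - spectralProjection x B ξ with hη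
  obtain ⟨g, hg, hgt⟩ := exists_seq x ![η] ![ξ] hB
  have hgt1 := (hgt 0).1
  have hgt2 := (hgt 0).2
  simp only [Matrix.cons_val_zero] at hgt1 hgt2
  rw [← inner_spectralProjection_eq_polar x hB] at hgt1
  have h1 : Tendsto (fun m => ‖inner ℂ η (cfc (f n) x ξ) - inner ℂ η (cfc (g m) x ξ)‖) atTop
      (𝓝 ‖inner ℂ η (cfc (f n) x ξ) - inner ℂ η (spectralProjection x B ξ)‖) :=
    (tendsto_const_nhds.sub hgt1).norm
  have h2 := ((hgt2.const_add c).sqrt).const_mul ‖η‖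
  rw [add_zero] at h2
  have h3 := le_of_tendsto_of_tendsto' h1 h2 fun m => by
    rw [← inner_sub_right]
    refine (norm_inner_le_norm _ _).trans ?_
    gcongr
    exact Real.le_sqrt_of_sq_le (norm_cfc_sub_sq_le x ξ hB (f n) (g m) (hf n) (hg m))
  rw [← inner_sub_right, ← hη, inner_self_eq_norm_sq_to_K] at h3
  have h4 : ‖η‖ * ‖η‖ ≤ ‖η‖ * √c := by simpa [sq] using h3
  rcases (norm_nonneg η).eq_or_lt with h0 | h0
  · rw [← h0]; exact Real.sqrt_nonneg _
  · exact le_of_mul_le_mul_left h4 h0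

lemma inner_spectralProjection_mul (x : H →L[ℂ] H) {A B : Set ℝ} (hA : MeasurableSet A)
    (hB : MeasurableSet B) (ξ : H) :
    inner ℂ (spectralProjection x A ξ) (spectralProjection x B ξ)
      = ((vectorMeasure x ξ).real (A ∩ B) : ℂ) := by
  obtain ⟨f, hf, hft⟩ := exists_seq x ![ξ] ![ξ] hA
  obtain ⟨g, hg, hgt⟩ := exists_seq x ![ξ] ![ξ] hB
  have hft := (hft 0).2
  have hgt := (hgt 0).2
  simp only [Matrix.cons_val_zero] at hft hgt
  have h1 := (tendsto_cfc_spectralProjection x ξ hA f hf hft).inner (𝕜 := ℂ)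
    (tendsto_cfc_spectralProjection x ξ hB g hg hgt)
  refine tendsto_nhds_unique h1 ?_
  have h2 : Tendsto (fun n => ∫ t, f n t * g n t ∂(vectorMeasure x ξ)) atTop
      (𝓝 ((vectorMeasure x ξ).real (A ∩ B))) := by
    rw [tendsto_iff_dist_tendsto_zero]
    have h3 := hft.add hgt
    rw [add_zero] at h3
    refine squeeze_zero (fun _ => dist_nonneg) (fun n => ?_) h3
    have hiA : Integrable (A.indicator fun _ => (1 : ℝ)) (vectorMeasure x ξ) :=
      (integrable_const (1 : ℝ)).indicator hA
    have hiB : Integrable (B.indicator fun _ => (1 : ℝ)) (vectorMeasure x ξ) :=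
      (integrable_const (1 : ℝ)).indicator hB
    have hif := (hiA.sub (integrable_cc x ξ (f n))).norm
    have hig := (hiB.sub (integrable_cc x ξ (g n))).norm
    have h4 : (vectorMeasure x ξ).real (A ∩ B)
        = ∫ t, (A ∩ B).indicator (fun _ => (1 : ℝ)) t ∂(vectorMeasure x ξ) := by
      rw [integral_indicator (hA.inter hB)]; simp
    have hfg : Integrable (fun t => f n t * g n t) (vectorMeasure x ξ) :=
      integrable_cc x ξ (f n * g n)
    rw [h4, dist_comm, Real.dist_eq, ← integral_sub
      ((integrable_const (1 : ℝ)).indicator (hA.inter hB)) hfg]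
    refine abs_integral_le_integral_abs.trans ?_
    refine le_trans ?_ (integral_add hif hig).le
    refine integral_mono_of_nonneg (.of_forall fun t => abs_nonneg _) (hif.add hig)
      (.of_forall fun t => ?_)
    simp only [Pi.sub_apply, Pi.add_apply, Real.norm_eq_abs]
    rw [show (A ∩ B).indicator (fun _ => (1 : ℝ)) t
      = A.indicator (fun _ => (1 : ℝ)) t * B.indicator (fun _ => (1 : ℝ)) t by
        by_cases ha : t ∈ A <;> by_cases hb : t ∈ B <;> simp [ha, hb]]
    have hb : 0 ≤ B.indicator (fun _ => (1 : ℝ)) t ∧ B.indicator (fun _ => (1 : ℝ)) t ≤ 1 := by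
      by_cases hb : t ∈ B <;> simp [hb]
    set a := A.indicator (fun _ => (1 : ℝ)) t
    set b := B.indicator (fun _ => (1 : ℝ)) t
    rw [show a * b - f n t * g n t = (a - f n t) * b + f n t * (b - g n t) by ring]
    refine (abs_add_le _ _).trans ?_
    rw [abs_mul, abs_mul, abs_of_nonneg hb.1, abs_of_nonneg (hf n t).1]
    exact add_le_add (mul_le_of_le_one_right (abs_nonneg _) hb.2)
      (mul_le_of_le_one_left (abs_nonneg _) (hf n t).2)
  refine ((Complex.continuous_ofReal.tendsto _).comp h2).congr fun n => ?_
  exact (inner_cfc_cfc x (f n) (g n) ξ).symm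

lemma isSelfAdjoint_spectralProjection (x : H →L[ℂ] H) (B : Set ℝ) :
    IsSelfAdjoint (spectralProjection x B) := by
  by_cases hB : MeasurableSet B
  swap
  · rw [spectralProjection, dif_neg hB]; exact .zero _
  refine operator_ext fun ξ => ?_
  rw [ContinuousLinearMap.star_eq_adjoint, ContinuousLinearMap.adjoint_inner_right,
    ← inner_conj_symm, inner_spectralProjection x hB, Complex.conj_ofReal]

lemma vectorMeasure_compl_spectrum (x : H →L[ℂ] H) (ξ : H) :
    vectorMeasure x ξ (spectrum ℝ x)ᶜ = 0 := by
  rw [(spectrum.isClosed x).isOpen_compl.measure_eq_iSup_isCompact]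
  refine le_antisymm (iSup_le fun K => iSup_le fun hKs => iSup_le fun hK => ?_) zero_le
  obtain ⟨f, hf1, hf0, hfc, hf⟩ := exists_continuous_one_zero_of_isCompact hK
    (spectrum.isClosed x) (Set.disjoint_left.2 hKs)
  refine (RealRMK.rieszMeasure_le_of_eq_one (vectorFunctional x ξ) (f := ⟨f, hfc⟩)
    (fun t => (hf t).1) hK (fun t ht => hf1 ht)).trans ?_
  have : cfc f x = 0 := by
    rw [cfc_congr (g := fun _ => 0) (fun t ht => hf0 ht), cfc_const_zero]
  have h2 : vectorFunctional x ξ ⟨f, hfc⟩ = (inner ℂ ξ (cfc f x ξ)).re := rfl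
  rw [h2, this]
  simp

/-- `∫ f dμ_ξ = ⟨ξ, f(x) ξ⟩` for all continuous `f`. -/
lemma integral_vectorMeasure_of_continuous (x : H →L[ℂ] H) (ξ : H) {f : ℝ → ℝ}
    (hf : Continuous f) :
    Integrable f (vectorMeasure x ξ) ∧
      inner ℂ ξ (cfc f x ξ) = ((∫ t, f t ∂(vectorMeasure x ξ) : ℝ) : ℂ) := by
  obtain ⟨u, hu1, -, huc, -⟩ := exists_continuous_one_zero_of_isCompact
    (spectrum.isCompact (𝕜 := ℝ) x) isClosed_empty (Set.disjoint_empty _)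
  let g : C_c(ℝ, ℝ) := ⟨⟨fun t => f t * u t, by fun_prop⟩, huc.mul_left⟩
  have hae : f =ᵐ[vectorMeasure x ξ] g := by
    have : ∀ᵐ t ∂(vectorMeasure x ξ), t ∈ spectrum ℝ x := vectorMeasure_compl_spectrum x ξ
    filter_upwards [this] with t ht
    change f t = f t * u t
    rw [hu1 ht]; simp
  have hcfc : cfc f x = cfc g x := cfc_congr fun t ht => by
    change f t = f t * u t
    rw [hu1 ht]; simp
  refine ⟨(integrable_cc x ξ g).congr hae.symm, ?_⟩
  rw [integral_congr_ae hae, integral_vectorMeasure, hcfc]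
  exact inner_cfc_eq_re x g ξ

/-- `E` is the spectral measure of the self-adjoint operator `x`: a projection-valued Borel
measure on `ℝ`, supported on the spectrum of `x`, with `x = ∫ t dE(t)` (in the weak sense). -/
structure IsSpectralMeasure (x : H →L[ℂ] H) (E : Set ℝ → H →L[ℂ] H) : Prop where
  isStarProjection : ∀ B, MeasurableSet B → IsStarProjection (E B)
  univ : E Set.univ = 1
  inter : ∀ A B, MeasurableSet A → MeasurableSet B → E (A ∩ B) = E A * E B
  hasSum : ∀ B : ℕ → Set ℝ, (∀ i, MeasurableSet (B i)) → Pairwise (Function.onFun Disjoint B) →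
    ∀ ξ, HasSum (fun i => inner ℂ ξ (E (B i) ξ)) (inner ℂ ξ (E (⋃ i, B i) ξ))
  compl_spectrum : E (spectrum ℝ x)ᶜ = 0
  integral : ∀ (ξ : H) (μ : Measure ℝ),
    (∀ B, MeasurableSet B → μ B = ENNReal.ofReal (inner ℂ ξ (E B ξ)).re) →
      Integrable (fun t => t) μ ∧ inner ℂ ξ (x ξ) = ((∫ t, t ∂μ : ℝ) : ℂ)

theorem isSpectralMeasure_spectralProjection {x : H →L[ℂ] H} (hx : IsSelfAdjoint x) :
    IsSpectralMeasure x (spectralProjection x) := by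
  have hinter : ∀ A B, MeasurableSet A → MeasurableSet B →
      spectralProjection x (A ∩ B) = spectralProjection x A * spectralProjection x B := by
    refine fun A B hA hB => operator_ext fun ξ => ?_
    rw [inner_spectralProjection x (hA.inter hB), ← inner_spectralProjection_mul x hA hB]
    exact ContinuousLinearMap.isSelfAdjoint_iff_isSymmetric.mp
      (isSelfAdjoint_spectralProjection x A) ξ (spectralProjection x B ξ)
  refine ⟨fun B hB => ⟨?_, isSelfAdjoint_spectralProjection x B⟩, ?_, hinter, ?_, ?_, ?_⟩
  · rw [IsIdempotentElem, ← hinter B B hB hB, Set.inter_self]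
  · refine operator_ext fun ξ => ?_
    rw [inner_spectralProjection x .univ]
    have h := (integral_vectorMeasure_of_continuous x ξ (f := fun _ => 1) continuous_const).2
    rw [cfc_const_one ℝ x] at h
    rw [h]
    simp
  · intro B hB hd ξ
    simp only [inner_spectralProjection x (hB _), inner_spectralProjection x (.iUnion hB)]
    rw [Complex.hasSum_ofReal]
    have hne : ∑' i, vectorMeasure x ξ (B i) ≠ ⊤ := by
      rw [← measure_iUnion hd hB]; exact measure_ne_top _ _
    rw [Measure.real, measure_iUnion hd hB, ENNReal.tsum_toReal_eq fun i => measure_ne_top _ _]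
    exact ENNReal.hasSum_toReal hne
  · refine operator_ext fun ξ => ?_
    rw [inner_spectralProjection x (spectrum.isClosed x).isOpen_compl.measurableSet,
      Measure.real, vectorMeasure_compl_spectrum]
    simp
  · intro ξ μ hμ
    have : μ = vectorMeasure x ξ := by
      ext B hB
      rw [hμ B hB, inner_spectralProjection x hB]
      simp
    have h := integral_vectorMeasure_of_continuous x ξ continuous_id
    rw [cfc_id ℝ x] at h
    rw [this]
    exact h

end SpectralCalculus

namespace QuantumProbability

variable {H : Type*} [NormedAddCommGroup H] [InnerProductSpace ℂ H] [CompleteSpace H]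

lemma mem_of_commute (M : VonNeumannAlgebra H) {T : H →L[ℂ] H}
    (h : ∀ y ∈ M.commutant, Commute T y) : T ∈ M.toStarSubalgebra := by
  have h2 : T ∈ M.commutant.commutant :=
    VonNeumannAlgebra.mem_commutant_iff.2 fun y hy => (h y hy).symm.eq
  rw [VonNeumannAlgebra.commutant_commutant] at h2
  exact h2

/-- `τ` is a normal faithful tracial state on the von Neumann algebra `M`. Normality means that
`τ` preserves the supremum of every bounded increasing net of self-adjoint elements. -/
structure IsNormalFaithfulTracialState (M : VonNeumannAlgebra H)
    (τ : M.toStarSubalgebra →ₗ[ℂ] ℂ) : Prop where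
  map_one : τ 1 = 1
  nonneg : ∀ a, 0 ≤ τ (star a * a)
  faithful : ∀ a, τ (star a * a) = 0 → a = 0
  tracial : ∀ a b, τ (a * b) = τ (b * a)
  normal : ∀ (D : Set M.toStarSubalgebra) (a : M.toStarSubalgebra), D.Nonempty →
    DirectedOn (· ≤ ·) D → (∀ d ∈ D, IsSelfAdjoint d) → IsLUB D a →
      IsLUB ((fun d => (τ d).re) '' D) (τ a).re

/-- The von Neumann algebra `W*(S)` generated by a set `S` of operators, i.e. the double
commutant of `S ∪ S*`. -/
noncomputable def generated (S : Set (H →L[ℂ] H)) : VonNeumannAlgebra H where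
  toStarSubalgebra := StarSubalgebra.centralizer ℂ
    (StarSubalgebra.centralizer ℂ S : Set (H →L[ℂ] H))
  centralizer_centralizer' := by simp

lemma subset_generated (S : Set (H →L[ℂ] H)) :
    S ⊆ (generated S).toStarSubalgebra := by
  change S ⊆ Set.centralizer (_ ∪ star _)
  rw [StarMemClass.star_coe_eq, Set.union_self]
  exact Set.subset_union_left.trans Set.subset_centralizer_centralizer

lemma generated_le {S : Set (H →L[ℂ] H)} {N : VonNeumannAlgebra H}
    (h : S ⊆ N.toStarSubalgebra) : (generated S).toStarSubalgebra ≤ N.toStarSubalgebra := by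
  refine fun T hT => mem_of_commute N fun y hy => ?_
  have hT' : T ∈ Set.centralizer _ := hT
  refine (Set.mem_centralizer_iff.1 hT' y (Or.inl ?_)).symm
  refine Set.mem_centralizer_iff.2 fun s hs => ?_
  refine VonNeumannAlgebra.mem_commutant_iff.1 hy s ?_
  rcases hs with hs | hs
  · exact h hs
  · have := star_mem (s := N.toStarSubalgebra) (h hs)
    rwa [star_star] at this

variable {M : VonNeumannAlgebra H}

/-- The spectral projection `e_B(a)` of a self-adjoint element `a` of `M`, as an element of `M`. -/
noncomputable def spectralProj (a : M.toStarSubalgebra) (B : Set ℝ) : M.toStarSubalgebra :=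
  ⟨SpectralCalculus.spectralProjection (a : H →L[ℂ] H) B, mem_of_commute M fun _ hy =>
    SpectralCalculus.commute_spectralProjection
      (VonNeumannAlgebra.mem_commutant_iff.1 hy a a.2) B⟩

/-- The absolute value `|a| = (a* a)^{1/2}` of an element `a` of `M`, as an element of `M`. -/
noncomputable def absVal (a : M.toStarSubalgebra) : M.toStarSubalgebra :=
  ⟨CFC.abs (a : H →L[ℂ] H), mem_of_commute M fun _ hy =>
    Commute.cfcAbs_left (VonNeumannAlgebra.mem_commutant_iff.1 hy a a.2)
      (VonNeumannAlgebra.mem_commutant_iff.1 (star_mem hy) a a.2)⟩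

/-- The number `τ(e_B(|a|))`. -/
noncomputable def absTail (τ : M.toStarSubalgebra →ₗ[ℂ] ℂ) (a : M.toStarSubalgebra)
    (B : Set ℝ) : ℝ :=
  (τ (spectralProj (absVal a) B)).re

/-- Weak full independence of `x_0, …, x_{n-1}` (indices shifted by one): for every `0 < j < n`,
`τ(ab) = τ(a)τ(b)` for all `a ∈ W*(x_i : i < j)` and `b ∈ W*(x_i : j ≤ i)`. -/
def WeaklyFullyIndependent (τ : M.toStarSubalgebra →ₗ[ℂ] ℂ) {n : ℕ}
    (x : Fin n → M.toStarSubalgebra) : Prop :=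
  ∀ j : Fin n, 0 < (j : ℕ) → ∀ a b : M.toStarSubalgebra,
    (a : H →L[ℂ] H) ∈ generated {y | ∃ i, i < j ∧ y = x i} →
    (b : H →L[ℂ] H) ∈ generated {y | ∃ i, j ≤ i ∧ y = x i} →
      τ (a * b) = τ a * τ b

/-- The partial sums `s_k = x_0 + ⋯ + x_k` (indices shifted by one, so that the last partial
sum is `∑ i, x i`). -/
noncomputable def partialSum {n : ℕ} (x : Fin n → M.toStarSubalgebra) (k : Fin n) : M.toStarSubalgebra :=
  ∑ i ∈ Finset.Iic k, x i

/-- The constant `M_λ = 1 / min_k τ(e_{(-∞, λ/2]}(|s_n - s_k|)) ∈ [0, ∞]`, with `1 / 0 = ∞`. -/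
noncomputable def ottavianiConst (τ : M.toStarSubalgebra →ₗ[ℂ] ℂ) {n : ℕ} [NeZero n]
    (x : Fin n → M.toStarSubalgebra) (lam : ℝ) : ℝ≥0∞ :=
  1 / ENNReal.ofReal (Finset.univ.inf' Finset.univ_nonempty fun k : Fin n =>
    absTail τ (∑ i, x i - partialSum x k) (Set.Iic (lam / 2)))

end QuantumProbability

/-! ### Norm estimates and limits of powers from spectral projections -/

namespace SpectralCalculus

variable {H : Type*} [NormedAddCommGroup H] [InnerProductSpace ℂ H] [CompleteSpace H]

/-! Classically one splits `{max |s_k| > 2λ}` according to the first `k` at which the level is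
passed and applies independence to each piece. Here `p` plays the part of that event and is built as
an orthogonal sum of such pieces.

Write `q_k = e_{(2λ,∞)}(|s_k|)`, `r_k = e_{(-∞,λ/2]}(|s_n - s_k|)`, `E = e_{(λ/2,∞)}(|s_n|)`. Given
the projection `p` built so far, the next piece is a projection `m` below both `q_k` and `1 - p`. In
a finite trace it can be taken with `τ(m) ≥ τ(q_k) + τ(1 - p) - 1 = τ(q_k) - τ(p)`
(`exists_subprojection`), so `τ(p + m) ≥ τ(q_k)`. Every `q_k` is thus dominated in trace with no
loss; the factors `1/2^{k-1}` are only discarded at the end.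

For the upper bound, `m` lies in `W*(x_1, …, x_k)`, so independence gives `τ(m r_k) = τ(m) τ(r_k)`.
Since `s_k` and `s_n` commute, the triangle inequality on vectors yields `q_k r_k (1 - E) = 0`
(`spectralProjection_mul_eq_zero`), whence `m r_k = m r_k E` and `τ(m) τ(r_k) ≤ τ(E m)`. Summing
over the pieces, `(min_k τ(r_k)) τ(p) ≤ τ(E p) ≤ τ(E)`. The estimate `τ(E m r_k) ≤ τ(E m)` needs `E
m` to be a projection, so `m` must commute with `E`; this is why the subprojection is required to
inherit commutation. -/

lemma vectorMeasure_ae_of_mem_spectrum {x : H →L[ℂ] H} {P : ℝ → Prop}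
    (h : ∀ t ∈ spectrum ℝ x, P t) (ξ : H) : ∀ᵐ t ∂(vectorMeasure x ξ), P t := by
  have : ∀ᵐ t ∂(vectorMeasure x ξ), t ∈ spectrum ℝ x := vectorMeasure_compl_spectrum x ξ
  filter_upwards [this] with t ht using h t ht

lemma integral_pow_vectorMeasure {x : H →L[ℂ] H} (hx : IsSelfAdjoint x) (n : ℕ) (ξ : H) :
    Integrable (fun t => t ^ n) (vectorMeasure x ξ) ∧
      inner ℂ ξ ((x ^ n) ξ) = ((∫ t, t ^ n ∂(vectorMeasure x ξ) : ℝ) : ℂ) := by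
  have h := integral_vectorMeasure_of_continuous x ξ (f := fun t => t ^ n) (continuous_pow n)
  rwa [cfc_pow_id (R := ℝ) x n] at h

lemma norm_sq_eq_vectorMeasure {x : H →L[ℂ] H} (hx : IsSelfAdjoint x) (ξ : H) :
    ‖ξ‖ ^ 2 = (vectorMeasure x ξ).real Set.univ := by
  have h := (integral_pow_vectorMeasure hx 0 ξ).2
  simp only [pow_zero, one_apply_eq_self, inner_self_eq_norm_sq_to_K, integral_const, smul_eq_mul,
    mul_one] at h
  refine Complex.ofReal_injective ?_
  rw [← h]; push_cast; rfl

lemma norm_sq_apply_eq_integral {x : H →L[ℂ] H} (hx : IsSelfAdjoint x) (ξ : H) :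
    ‖x ξ‖ ^ 2 = ∫ t, t ^ 2 ∂(vectorMeasure x ξ) := by
  have h := (integral_pow_vectorMeasure hx 2 ξ).2
  have h2 : inner ℂ ξ ((x ^ 2) ξ) = inner ℂ (x ξ) (x ξ) := by
    rw [pow_two]
    exact (ContinuousLinearMap.isSelfAdjoint_iff_isSymmetric.mp hx ξ (x ξ)).symm
  rw [h2, inner_self_eq_norm_sq_to_K] at h
  refine Complex.ofReal_injective ?_
  rw [← h]; push_cast; rfl

lemma spectralProjection_add_compl {x : H →L[ℂ] H} (hx : IsSelfAdjoint x) {B : Set ℝ}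
    (hB : MeasurableSet B) : spectralProjection x B + spectralProjection x Bᶜ = 1 := by
  refine operator_ext fun ξ => ?_
  rw [add_apply, inner_add_right, inner_spectralProjection x hB,
    inner_spectralProjection x hB.compl, ← Complex.ofReal_add, measureReal_add_measureReal_compl hB,
    ← norm_sq_eq_vectorMeasure hx]
  simp

/-- A vector in the range of `e_B(x)` has spectral measure concentrated on `B`. -/
lemma vectorMeasure_ae_mem {x : H →L[ℂ] H} (hx : IsSelfAdjoint x) {B : Set ℝ}
    (hB : MeasurableSet B) {ξ : H} (h : spectralProjection x B ξ = ξ) :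
    ∀ᵐ t ∂(vectorMeasure x ξ), t ∈ B := by
  have h1 : spectralProjection x Bᶜ ξ = 0 := by
    have := congrArg (fun T : H →L[ℂ] H => T ξ) (spectralProjection_add_compl hx hB)
    simpa [h] using this
  have h2 := inner_spectralProjection x hB.compl ξ
  rw [h1, inner_zero_right] at h2
  have h3 : (vectorMeasure x ξ).real Bᶜ = 0 := by exact_mod_cast h2.symm
  rwa [measureReal_eq_zero_iff] at h3

lemma norm_apply_le_of_spectralProjection_Iic {x : H →L[ℂ] H} (hx : 0 ≤ x) {c : ℝ} (hc : 0 ≤ c)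
    {ξ : H} (h : spectralProjection x (Set.Iic c) ξ = ξ) : ‖x ξ‖ ≤ c * ‖ξ‖ := by
  have hsa : IsSelfAdjoint x := .of_nonneg hx
  refine (sq_le_sq₀ (norm_nonneg _) (by positivity)).1 ?_
  rw [norm_sq_apply_eq_integral hsa, mul_pow, norm_sq_eq_vectorMeasure hsa ξ]
  calc ∫ t, t ^ 2 ∂(vectorMeasure x ξ) ≤ ∫ _, c ^ 2 ∂(vectorMeasure x ξ) := by
        refine integral_mono_ae (integral_pow_vectorMeasure hsa 2 ξ).1 (integrable_const _) ?_
        filter_upwards [vectorMeasure_ae_mem hsa measurableSet_Iic h,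
          vectorMeasure_ae_of_mem_spectrum (fun t ht => spectrum_nonneg_of_nonneg hx ht) ξ]
          with t ht ht0
        exact pow_le_pow_left₀ ht0 ht 2
    _ = c ^ 2 * (vectorMeasure x ξ).real Set.univ := by simp [mul_comm]

lemma le_norm_apply_of_spectralProjection_Ioi {x : H →L[ℂ] H} (hx : IsSelfAdjoint x) {c : ℝ}
    (hc : 0 ≤ c) {ξ : H} (h : spectralProjection x (Set.Ioi c) ξ = ξ) : c * ‖ξ‖ ≤ ‖x ξ‖ := by
  refine (sq_le_sq₀ (by positivity) (norm_nonneg _)).1 ?_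
  rw [norm_sq_apply_eq_integral hx, mul_pow, norm_sq_eq_vectorMeasure hx ξ]
  calc c ^ 2 * (vectorMeasure x ξ).real Set.univ = ∫ _, c ^ 2 ∂(vectorMeasure x ξ) := by
        simp [mul_comm]
    _ ≤ ∫ t, t ^ 2 ∂(vectorMeasure x ξ) := by
        refine integral_mono_ae (integrable_const _) (integral_pow_vectorMeasure hx 2 ξ).1 ?_
        filter_upwards [vectorMeasure_ae_mem hx measurableSet_Ioi h] with t ht
        exact pow_le_pow_left₀ hc (le_of_lt ht) 2

/-- The powers of a positive contraction converge weakly to its spectral projection for `{1}`. -/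
lemma tendsto_inner_pow_self {x : H →L[ℂ] H} (h0 : 0 ≤ x) (h1 : x ≤ 1) (ξ : H) :
    Tendsto (fun n : ℕ => inner ℂ ξ ((x ^ n) ξ)) atTop
      (𝓝 (inner ℂ ξ (spectralProjection x {1} ξ))) := by
  have hsa : IsSelfAdjoint x := .of_nonneg h0
  rw [inner_spectralProjection x (measurableSet_singleton 1)]
  simp only [(integral_pow_vectorMeasure hsa _ ξ).2]
  refine (Complex.continuous_ofReal.tendsto _).comp ?_
  have h2 : (vectorMeasure x ξ).real {1}
      = ∫ t, ({1} : Set ℝ).indicator (fun _ => (1 : ℝ)) t ∂(vectorMeasure x ξ) := by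
    rw [integral_indicator (measurableSet_singleton 1)]; simp [Measure.real]
  have hle := (CFC.le_one_iff (R := ℝ) x).1 h1
  have hspec := vectorMeasure_ae_of_mem_spectrum
    (fun t ht => And.intro (spectrum_nonneg_of_nonneg h0 ht) (hle t ht)) ξ
  rw [h2]
  -- On `[0, 1]`, which carries the measure, `t ^ n` decreases to the indicator of `{1}`.
  refine tendsto_integral_of_dominated_convergence (fun _ => 1)
    (fun n => (continuous_pow n).aestronglyMeasurable) (integrable_const _) (fun n => ?_) ?_
  · filter_upwards [hspec] with t ht
    rw [Real.norm_eq_abs, abs_of_nonneg (pow_nonneg ht.1 n)]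
    exact pow_le_one₀ ht.1 ht.2
  · filter_upwards [hspec] with t ht
    rcases ht.2.eq_or_lt with rfl | hlt
    · simp
    · rw [Set.indicator_of_notMem (by simpa using hlt.ne)]
      exact tendsto_pow_atTop_nhds_zero_of_lt_one ht.1 hlt

lemma tendsto_inner_pow {x : H →L[ℂ] H} (h0 : 0 ≤ x) (h1 : x ≤ 1) (ξ η : H) :
    Tendsto (fun n : ℕ => inner ℂ ξ ((x ^ n) η)) atTop
      (𝓝 (inner ℂ ξ (spectralProjection x {1} η))) := by
  have key := tendsto_inner_pow_self h0 h1
  rw [inner_polar]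
  simp only [inner_polar _ ξ η]
  exact (((key _).sub (key _)).sub (((key _).sub (key _)).const_mul Complex.I)).div_const 4

lemma mul_spectralProjection_singleton_one {x : H →L[ℂ] H} (h0 : 0 ≤ x) (h1 : x ≤ 1) :
    x * spectralProjection x {1} = spectralProjection x {1} := by
  rw [← (commute_spectralProjection (Commute.refl x) {1}).eq]
  refine operator_ext fun ξ => ?_
  -- Replacing `ξ` by `x ξ` only shifts the sequence of powers by one, so the limit is the same.
  refine tendsto_nhds_unique (tendsto_inner_pow h0 h1 ξ (x ξ)) ?_
  refine ((tendsto_inner_pow h0 h1 ξ ξ).comp (tendsto_add_atTop_nat 1)).congr fun n => ?_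
  simp

lemma isStarProjection_spectralProjection {x : H →L[ℂ] H} (hx : IsSelfAdjoint x) {B : Set ℝ}
    (hB : MeasurableSet B) : IsStarProjection (spectralProjection x B) :=
  (isSpectralMeasure_spectralProjection hx).isStarProjection B hB

/-- Both squared norms equal `⟨ξ, x* x ξ⟩`. Spectral information on `|x|` thereby becomes a norm
estimate for `x` itself, to which the triangle inequality applies. -/
lemma norm_abs_apply (x : H →L[ℂ] H) (ξ : H) : ‖CFC.abs x ξ‖ = ‖x ξ‖ := by
  have h : inner ℂ (CFC.abs x ξ) (CFC.abs x ξ) = inner ℂ (x ξ) (x ξ) := by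
    have hs := ContinuousLinearMap.isSelfAdjoint_iff_isSymmetric.mp
      (.of_nonneg (CFC.abs_nonneg x)) ξ (CFC.abs x ξ)
    refine hs.trans ?_
    rw [← ContinuousLinearMap.adjoint_inner_right x ξ (x ξ)]
    exact congrArg (fun T : H →L[ℂ] H => inner ℂ ξ (T ξ)) (CFC.abs_mul_abs x)
  rw [inner_self_eq_norm_sq_to_K, inner_self_eq_norm_sq_to_K] at h
  have h2 : ‖CFC.abs x ξ‖ ^ 2 = ‖x ξ‖ ^ 2 := Complex.ofReal_injective (by push_cast; exact h)
  exact (sq_eq_sq₀ (norm_nonneg _) (norm_nonneg _)).1 h2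

lemma norm_apply_le_of_spectralProjection_abs {x : H →L[ℂ] H} {c : ℝ} (hc : 0 ≤ c) {ξ : H}
    (h : spectralProjection (CFC.abs x) (Set.Iic c) ξ = ξ) : ‖x ξ‖ ≤ c * ‖ξ‖ :=
  norm_abs_apply x ξ ▸ norm_apply_le_of_spectralProjection_Iic (CFC.abs_nonneg x) hc h

lemma le_norm_apply_of_spectralProjection_abs {x : H →L[ℂ] H} {c : ℝ} (hc : 0 ≤ c) {ξ : H}
    (h : spectralProjection (CFC.abs x) (Set.Ioi c) ξ = ξ) : c * ‖ξ‖ ≤ ‖x ξ‖ :=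
  norm_abs_apply x ξ ▸
    le_norm_apply_of_spectralProjection_Ioi (.of_nonneg (CFC.abs_nonneg x)) hc h

lemma spectralProjection_abs_Iic_add_Ioi (x : H →L[ℂ] H) (c : ℝ) :
    spectralProjection (CFC.abs x) (Set.Iic c) + spectralProjection (CFC.abs x) (Set.Ioi c) = 1 := by
  rw [← Set.compl_Iic]
  exact spectralProjection_add_compl (.of_nonneg (CFC.abs_nonneg x)) measurableSet_Iic

/-- Serves the last index, where `s_n - s_k = 0` and no later variables remain to which independence
could be applied. -/
lemma spectralProjection_abs_zero_Iic {c : ℝ} (hc : 0 < c) :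
    spectralProjection (CFC.abs (0 : H →L[ℂ] H)) (Set.Iic c) = 1 := by
  have h : spectralProjection (CFC.abs (0 : H →L[ℂ] H)) (Set.Ioi c) = 0 := by
    ext ξ
    have hid := (isStarProjection_spectralProjection (.of_nonneg (CFC.abs_nonneg (0 : H →L[ℂ] H)))
      (measurableSet_Ioi (a := c))).isIdempotentElem
    have h1 := le_norm_apply_of_spectralProjection_abs hc.le
      (congrArg (fun T : H →L[ℂ] H => T ξ) hid.eq)
    rw [zero_apply, norm_zero] at h1
    have h2 := nonpos_of_mul_nonpos_right h1 hc
    simpa using h2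
  rw [← spectralProjection_abs_Iic_add_Ioi (0 : H →L[ℂ] H) c, h, add_zero]

lemma commute_spectralProjection_abs {x y : H →L[ℂ] H} (hx : IsSelfAdjoint x) (h : Commute x y)
    (B : Set ℝ) : Commute (spectralProjection (CFC.abs x) B) y := by
  refine commute_spectralProjection ?_ B
  have hy : Commute x (star y) := by
    have := h.star_star
    rwa [hx.star_eq] at this
  exact h.cfcAbs_left hy

/-- If `x` and `y` commute, `|x| > 4c` and `|y - x| ≤ c` force `|y| > c`. -/
lemma spectralProjection_mul_eq_zero {x y : H →L[ℂ] H} (hx : IsSelfAdjoint x)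
    (hy : IsSelfAdjoint y) (hxy : Commute x y) {c : ℝ} (hc : 0 < c) :
    spectralProjection (CFC.abs x) (Set.Ioi (4 * c)) *
      spectralProjection (CFC.abs (y - x)) (Set.Iic c) *
        spectralProjection (CFC.abs y) (Set.Iic c) = 0 := by
  set q := spectralProjection (CFC.abs x) (Set.Ioi (4 * c)) with hq
  set r := spectralProjection (CFC.abs (y - x)) (Set.Iic c) with hr
  set f := spectralProjection (CFC.abs y) (Set.Iic c) with hf
  have hproj (z : H →L[ℂ] H) {B : Set ℝ} (hB : MeasurableSet B) :
      IsIdempotentElem (spectralProjection (CFC.abs z) B) :=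
    (isStarProjection_spectralProjection (.of_nonneg (CFC.abs_nonneg z)) hB).isIdempotentElem
  have hqy : Commute q y := commute_spectralProjection_abs hx hxy _
  have hqx : Commute q x := commute_spectralProjection_abs hx (.refl x) _
  have hqr : Commute q r := (commute_spectralProjection_abs (hy.sub hx)
    (hqy.sub_right hqx).symm _).symm
  have hfq : Commute f q := commute_spectralProjection_abs hy hqy.symm _
  have hfx : Commute f x := commute_spectralProjection_abs hy hxy.symm _
  have hfy : Commute f y := commute_spectralProjection_abs hy (.refl y) _
  have hrf : Commute r f := commute_spectralProjection_abs (hy.sub hx)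
    (hfy.sub_right hfx).symm _
  -- The three projections commute, so a vector in the range of `q r f` is fixed by each of them.
  have e1 : q * (q * r * f) = q * r * f := by
    simp only [← mul_assoc]; rw [(hproj x measurableSet_Ioi).eq]
  have e2 : r * (q * r * f) = q * r * f := by
    simp only [← mul_assoc]; rw [← hqr.eq, mul_assoc q r r, (hproj (y - x) measurableSet_Iic).eq]
  have e3 : f * (q * r * f) = q * r * f := by
    simp only [← mul_assoc]
    rw [hfq.eq, mul_assoc q f r, ← hrf.eq, ← mul_assoc, mul_assoc _ f f,
      (hproj y measurableSet_Iic).eq]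
  ext ξ
  set η := (q * r * f) ξ
  have h1 : 4 * c * ‖η‖ ≤ ‖x η‖ := le_norm_apply_of_spectralProjection_abs (by positivity)
    (congrArg (fun T : H →L[ℂ] H => T ξ) e1)
  have h2 : ‖(y - x) η‖ ≤ c * ‖η‖ := norm_apply_le_of_spectralProjection_abs hc.le
    (congrArg (fun T : H →L[ℂ] H => T ξ) e2)
  have h3 : ‖y η‖ ≤ c * ‖η‖ := norm_apply_le_of_spectralProjection_abs hc.le
    (congrArg (fun T : H →L[ℂ] H => T ξ) e3)
  have h4 : ‖x η‖ ≤ ‖y η‖ + ‖(y - x) η‖ := by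
    have : x η = y η - (y - x) η := by simp
    rw [this]; exact norm_sub_le _ _
  -- Together the bounds say `4c‖η‖ ≤ ‖x η‖ ≤ 2c‖η‖`.
  have h5 : c * ‖η‖ ≤ 0 := by nlinarith [mul_nonneg hc.le (norm_nonneg η)]
  simpa using nonpos_of_mul_nonpos_right h5 hc

end SpectralCalculus

/-! ### The spectral projection at `1` as an infimum -/

namespace SpectralCalculus

variable {H : Type*} [NormedAddCommGroup H] [InnerProductSpace ℂ H] [CompleteSpace H]

lemma nonneg_of_tendsto_inner {S : ℕ → H →L[ℂ] H} {L : H →L[ℂ] H} (hL : IsSelfAdjoint L)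
    (hS : ∀ᶠ n in atTop, 0 ≤ S n)
    (h : ∀ ξ, Tendsto (fun n => inner ℂ ξ (S n ξ)) atTop (𝓝 (inner ℂ ξ (L ξ)))) : 0 ≤ L := by
  rw [ContinuousLinearMap.nonneg_iff_isPositive, ContinuousLinearMap.isPositive_iff']
  refine ⟨hL, fun ξ => ?_⟩
  refine le_of_le_of_eq ?_ (ContinuousLinearMap.isSelfAdjoint_iff_isSymmetric.mp hL ξ ξ).symm
  refine ge_of_tendsto (h ξ) ?_
  filter_upwards [hS] with n hn
  rw [ContinuousLinearMap.nonneg_iff_isPositive] at hn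
  exact hn.inner_nonneg_right ξ

/-- The spectral projection for `{1}` of a positive contraction is the infimum of its even
powers. -/
lemma isGLB_even_pow {x : H →L[ℂ] H} (h0 : 0 ≤ x) (h1 : x ≤ 1) :
    IsGLB (Set.range fun n : ℕ => x ^ (2 * n)) (spectralProjection x {1}) := by
  have hsa : IsSelfAdjoint x := .of_nonneg h0
  have he := isSelfAdjoint_spectralProjection x {1}
  have hlim (ξ : H) := (tendsto_inner_pow_self h0 h1 ξ).comp
    (tendsto_id.const_mul_atTop' (two_pos (α := ℕ)))
  constructor
  · rintro _ ⟨k, rfl⟩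
    rw [← sub_nonneg]
    refine nonneg_of_tendsto_inner (S := fun n => x ^ (2 * k) - x ^ (2 * n))
      ((hsa.pow _).sub he) ?_ fun ξ => ?_
    · filter_upwards [eventually_ge_atTop k] with n hn
      exact sub_nonneg.2 (CStarAlgebra.pow_antitone h0 h1 (by lia))
    · simp only [sub_apply, inner_sub_right]
      exact (hlim ξ).const_sub _
  · intro b hb
    have hbn (n : ℕ) : b ≤ x ^ (2 * n) := hb ⟨n, rfl⟩
    -- The power with `n = 0` is `1`, so `1 - b` is positive and hence `b` is self-adjoint.
    have hbsa : IsSelfAdjoint b := by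
      have : IsSelfAdjoint (1 - b) := .of_nonneg (by simpa using hbn 0)
      simpa using (IsSelfAdjoint.one (H →L[ℂ] H)).sub this
    rw [← sub_nonneg]
    refine nonneg_of_tendsto_inner (S := fun n => x ^ (2 * n) - b) (he.sub hbsa)
      (.of_forall fun n => sub_nonneg.2 (hbn n)) fun ξ => ?_
    simp only [sub_apply, inner_sub_right]
    exact (hlim ξ).sub_const _

end SpectralCalculus

/-! ### Traces of projections and their common subprojections -/

namespace QuantumProbability

variable {H : Type*} [NormedAddCommGroup H] [InnerProductSpace ℂ H] [CompleteSpace H]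
  {M : VonNeumannAlgebra H} {τ : M.toStarSubalgebra →ₗ[ℂ] ℂ}

lemma isStarProjection_coe {e : M.toStarSubalgebra} (he : IsStarProjection e) :
    IsStarProjection (e : H →L[ℂ] H) :=
  ⟨congrArg Subtype.val he.isIdempotentElem.eq, congrArg Subtype.val he.isSelfAdjoint.star_eq⟩

lemma isStarProjection_of_coe {e : M.toStarSubalgebra} (he : IsStarProjection (e : H →L[ℂ] H)) :
    IsStarProjection e :=
  ⟨Subtype.ext he.isIdempotentElem.eq, Subtype.ext he.isSelfAdjoint.star_eq⟩

lemma isStarProjection_spectralProj_absVal (a : M.toStarSubalgebra) {B : Set ℝ}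
    (hB : MeasurableSet B) : IsStarProjection (spectralProj (absVal a) B) :=
  isStarProjection_of_coe (SpectralCalculus.isStarProjection_spectralProjection
    (.of_nonneg (CFC.abs_nonneg (a : H →L[ℂ] H))) hB)

namespace IsNormalFaithfulTracialState

lemma nonneg_of_isStarProjection (hτ : IsNormalFaithfulTracialState M τ) {e : M.toStarSubalgebra}
    (he : IsStarProjection e) : 0 ≤ τ e := by
  have h := hτ.nonneg e
  rwa [he.isSelfAdjoint.star_eq, he.isIdempotentElem.eq] at h

lemma nonneg_mul_of_isStarProjection (hτ : IsNormalFaithfulTracialState M τ)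
    {e f : M.toStarSubalgebra} (he : IsStarProjection e) (hf : IsStarProjection f) :
    0 ≤ τ (e * f) := by
  have h := hτ.nonneg (e * f)
  rwa [star_mul, he.isSelfAdjoint.star_eq, hf.isSelfAdjoint.star_eq, hτ.tracial, mul_assoc,
    ← mul_assoc f f e, hf.isIdempotentElem.eq, hτ.tracial, mul_assoc, he.isIdempotentElem.eq,
    hτ.tracial] at h

lemma re_mul_le (hτ : IsNormalFaithfulTracialState M τ) {e f : M.toStarSubalgebra}
    (he : IsStarProjection e) (hf : IsStarProjection f) : (τ (e * f)).re ≤ (τ e).re := by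
  have h := (Complex.nonneg_iff.1 (hτ.nonneg_mul_of_isStarProjection he hf.one_sub)).1
  rw [mul_sub, mul_one, map_sub, Complex.sub_re] at h
  linarith

/-- `y` intertwines `1 - y* y` and `1 - y y*`, so traciality moves one factor `y` around the powers.
This trades an operator adapted to `q` for one adapted to `r` in `exists_subprojection`. -/
lemma map_one_sub_star_mul_self_pow (hτ : IsNormalFaithfulTracialState M τ)
    (y : M.toStarSubalgebra) (n : ℕ) :
    τ ((1 - star y * y) ^ n) = τ ((1 - y * star y) ^ n) := by
  have hs : SemiconjBy y (1 - star y * y) (1 - y * star y) := by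
    rw [SemiconjBy]; noncomm_ring
  induction n with
  | zero => simp
  | succ n ih =>
    rw [pow_succ, pow_succ, mul_sub, mul_sub, map_sub, map_sub, mul_one, mul_one, ih,
      ← mul_assoc, hτ.tracial _ y, ← mul_assoc, (hs.pow_right n).eq, mul_assoc]

/-- The even powers of `a` decrease to the spectral projection at `1`, and normality carries the
bound to the limit. Even powers suffice and are convenient: for self-adjoint `z`, `z ^ (2 * n)` is
visibly a square. -/
lemma le_re_spectralProj_singleton_one (hτ : IsNormalFaithfulTracialState M τ)
    {a : M.toStarSubalgebra} (h0 : (0 : H →L[ℂ] H) ≤ a) (h1 : (a : H →L[ℂ] H) ≤ 1) {c : ℝ}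
    (hc : ∀ n : ℕ, c ≤ (τ (a ^ (2 * n))).re) : c ≤ (τ (spectralProj a {1})).re := by
  have hglb := SpectralCalculus.isGLB_even_pow h0 h1
  have ha : IsSelfAdjoint a := Subtype.ext (IsSelfAdjoint.of_nonneg h0).star_eq
  -- Normality speaks of increasing families, hence the passage to the complements `1 - a ^ (2 *
  -- n)`.
  have h := hτ.normal (Set.range fun n : ℕ => 1 - a ^ (2 * n)) (1 - spectralProj a {1})
    (Set.range_nonempty _) ?_ ?_ ⟨?_, ?_⟩
  · have h2 := h.2 (show 1 - c ∈ upperBounds _ by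
      rintro _ ⟨_, ⟨n, rfl⟩, rfl⟩
      simp only [map_sub, hτ.map_one, Complex.sub_re, Complex.one_re]
      linarith [hc n])
    rw [map_sub, hτ.map_one, Complex.sub_re, Complex.one_re] at h2
    linarith
  · refine directedOn_range.2 (Monotone.directed_le fun n k hnk => ?_)
    exact sub_le_sub_left (α := H →L[ℂ] H) (CStarAlgebra.pow_antitone h0 h1 (by lia)) 1
  · rintro _ ⟨n, rfl⟩
    exact (IsSelfAdjoint.one _).sub (ha.pow _)
  · rintro _ ⟨n, rfl⟩
    exact sub_le_sub_left (α := H →L[ℂ] H) (hglb.1 ⟨n, rfl⟩) 1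
  · intro b hb
    have h3 : (1 - b : H →L[ℂ] H) ≤ spectralProj a {1} := hglb.2 (by
      rintro _ ⟨n, rfl⟩
      exact sub_le_comm.1 (show (1 - a ^ (2 * n) : H →L[ℂ] H) ≤ b from hb ⟨n, rfl⟩))
    exact sub_le_comm.1 h3

/-- Two projections of `M` have a common subprojection of trace at least `τ(q) + τ(r) - 1`, which
commutes with everything that commutes with both. -/
lemma exists_subprojection (hτ : IsNormalFaithfulTracialState M τ) {q r : M.toStarSubalgebra}
    (hq : IsStarProjection q) (hr : IsStarProjection r) :
    ∃ m : M.toStarSubalgebra, IsStarProjection m ∧ q * m = m ∧ r * m = m ∧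
      (∀ y : H →L[ℂ] H, Commute (q : H →L[ℂ] H) y → Commute (r : H →L[ℂ] H) y →
        Commute (m : H →L[ℂ] H) y) ∧
      (τ q).re + (τ r).re - 1 ≤ (τ m).re := by
  -- A vector of the range of `q` lies in the range of `r` exactly when `y` kills it; the eigenspace
  -- of `T = 1 - y* y` at `1` is the kernel of `y`.
  set y := (1 - r) * q with hy
  have hysy : star y * y = q * (1 - r) * q := by
    rw [hy, star_mul, hq.isSelfAdjoint.star_eq, hr.one_sub.isSelfAdjoint.star_eq, mul_assoc,
      ← mul_assoc (1 - r), hr.one_sub.isIdempotentElem.eq, mul_assoc]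
  have hyys : y * star y = (1 - r) * q * (1 - r) := by
    rw [hy, star_mul, hq.isSelfAdjoint.star_eq, hr.one_sub.isSelfAdjoint.star_eq, mul_assoc,
      ← mul_assoc q q, hq.isIdempotentElem.eq, mul_assoc]
  set T : M.toStarSubalgebra := 1 - star y * y with hT
  have hqc := isStarProjection_coe hq
  have hrc := isStarProjection_coe hr
  have hTq : Commute (T : H →L[ℂ] H) q := by
    refine congrArg Subtype.val (show T * q = q * T from ?_)
    have h1 : q * (1 - r) * q * q = q * (1 - r) * q := by
      rw [mul_assoc, hq.isIdempotentElem.eq]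
    have h2 : q * (q * (1 - r) * q) = q * (1 - r) * q := by
      rw [← mul_assoc, ← mul_assoc, hq.isIdempotentElem.eq]
    rw [hT, hysy]
    generalize q * (1 - r) * q = w at h1 h2 ⊢
    rw [sub_mul, mul_sub, mul_one, one_mul, h1, h2]
  have hT1 : (T : H →L[ℂ] H) ≤ 1 := sub_le_self (1 : H →L[ℂ] H) (star_mul_self_nonneg (y : H →L[ℂ] H))
  have hT0 : (0 : H →L[ℂ] H) ≤ T := by
    have h2 : (star y * y : H →L[ℂ] H) ≤ 1 := by
      have h3 : (star y * y : H →L[ℂ] H) = star (q : H →L[ℂ] H) * (1 - r) * q := by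
        rw [hqc.isSelfAdjoint.star_eq]; exact congrArg Subtype.val hysy
      rw [h3]
      refine (star_left_conjugate_le_conjugate hrc.one_sub.le_one _).trans ?_
      rw [mul_one, hqc.isSelfAdjoint.star_eq, hqc.isIdempotentElem.eq]
      exact hqc.le_one
    exact sub_nonneg.2 h2
  set e := spectralProj T {1} with he
  have heP : IsStarProjection e := isStarProjection_of_coe
    (SpectralCalculus.isStarProjection_spectralProjection (.of_nonneg hT0)
      (measurableSet_singleton 1))
  have hTe : T * e = e := Subtype.ext (SpectralCalculus.mul_spectralProjection_singleton_one hT0 hT1)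
  have heq : e * q = q * e :=
    Subtype.ext (SpectralCalculus.commute_spectralProjection hTq {1}).eq
  have hye : y * e = 0 := by
    have h1 : star y * y * e = 0 := by
      have := hTe
      rwa [hT, sub_mul, one_mul, sub_eq_self] at this
    have h2 : star ((y * e : M.toStarSubalgebra) : H →L[ℂ] H) * (y * e : M.toStarSubalgebra) = 0 := by
      refine congrArg Subtype.val (show star (y * e) * (y * e) = 0 from ?_)
      rw [star_mul, mul_assoc, ← mul_assoc (star y), h1, mul_zero]
    exact Subtype.ext (CStarRing.star_mul_self_eq_zero_iff _ |>.1 h2)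
  -- `e` projects onto `ker y` and commutes with `q`, so `q e` projects onto the intersection of the
  -- ranges of `q` and `r`.
  refine ⟨q * e, hq.mul heP heq.symm, ?_, ?_, ?_, ?_⟩
  · rw [← mul_assoc, hq.isIdempotentElem.eq]
  · rw [hy, mul_assoc, sub_mul, one_mul, sub_eq_zero] at hye
    exact hye.symm
  · intro z hqz hrz
    have hTz : Commute (T : H →L[ℂ] H) z := by
      have h : (T : H →L[ℂ] H) = 1 - q * (1 - r) * q := by
        rw [hT, hysy]; rfl
      rw [h]
      exact (Commute.one_left z).sub_left
        ((hqz.mul_left ((Commute.one_left z).sub_left hrz)).mul_left hqz)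
    exact hqz.mul_left (SpectralCalculus.commute_spectralProjection hTz {1})
  · have h1 : (τ r).re ≤ (τ e).re := by
      refine hτ.le_re_spectralProj_singleton_one hT0 hT1 fun n => ?_
      rw [hT, hτ.map_one_sub_star_mul_self_pow, hyys]
      -- Unlike `T`, the operator `z = 1 - y y*` fixes the range of `r`, so all its powers do, and
      -- `τ(z ^ (2 * n)) ≥ τ(r)` follows.
      set z := 1 - (1 - r) * q * (1 - r) with hz
      have hzs : IsSelfAdjoint z := by
        rw [hz, ← hyys]
        exact (IsSelfAdjoint.one _).sub (IsSelfAdjoint.mul_star_self y)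
      have hzr : z * r = r := by
        have : (1 - r) * r = 0 := by rw [sub_mul, one_mul, hr.isIdempotentElem.eq, sub_self]
        rw [hz, sub_mul, one_mul, mul_assoc, this, mul_zero, sub_zero]
      have hznr (k : ℕ) : z ^ k * r = r := by
        induction k with
        | zero => simp
        | succ k ih => rw [pow_succ, mul_assoc, hzr, ih]
      -- By traciality this is `0 ≤ τ(z ^ (2 * n) (1 - r)) = τ(z ^ (2 * n)) - τ(r)`.
      have h := (Complex.nonneg_iff.1 (hτ.nonneg (z ^ n * (1 - r)))).1
      rw [star_mul, (hzs.pow n).star_eq, hr.one_sub.isSelfAdjoint.star_eq, mul_assoc,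
        hτ.tracial, mul_assoc, mul_assoc, hr.one_sub.isIdempotentElem.eq, ← mul_assoc, ← pow_add,
        ← two_mul, mul_sub, hznr, mul_one, map_sub, Complex.sub_re] at h
      linarith
    -- `τ(q e) = τ(e) - τ((1 - q) e) ≥ τ(r) - τ(1 - q)`.
    have h2 := hτ.re_mul_le hq.one_sub heP
    rw [sub_mul, one_mul, map_sub, map_sub, hτ.map_one, Complex.sub_re, Complex.sub_re,
      Complex.one_re] at h2
    linarith

end IsNormalFaithfulTracialState

end QuantumProbability

/-! ### Construction of the projection -/

namespace QuantumProbability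

variable {H : Type*} [NormedAddCommGroup H] [InnerProductSpace ℂ H] [CompleteSpace H]
  {M : VonNeumannAlgebra H} {τ : M.toStarSubalgebra →ₗ[ℂ] ℂ}

lemma commute_of_mem_commutant {N : VonNeumannAlgebra H} {a y : H →L[ℂ] H}
    (ha : a ∈ N.toStarSubalgebra) (hy : y ∈ N.commutant) : Commute a y :=
  VonNeumannAlgebra.mem_commutant_iff.1 hy a ha

lemma spectralProj_absVal_mem {N : VonNeumannAlgebra H} {a : M.toStarSubalgebra}
    (ha : (a : H →L[ℂ] H) ∈ N.toStarSubalgebra) (B : Set ℝ) :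
    (spectralProj (absVal a) B : H →L[ℂ] H) ∈ N.toStarSubalgebra :=
  mem_of_commute N fun _ hy => SpectralCalculus.commute_spectralProjection
    (Commute.cfcAbs_left (commute_of_mem_commutant ha hy)
      (commute_of_mem_commutant ha (star_mem hy))) B

lemma coe_sum_mem {N : VonNeumannAlgebra H} {ι : Type*} (s : Finset ι)
    {x : ι → M.toStarSubalgebra} (h : ∀ i ∈ s, (x i : H →L[ℂ] H) ∈ N.toStarSubalgebra) :
    ((∑ i ∈ s, x i : M.toStarSubalgebra) : H →L[ℂ] H) ∈ N.toStarSubalgebra := by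
  rw [AddSubmonoidClass.coe_finsetSum]
  exact sum_mem h

lemma generated_mono {S T : Set (H →L[ℂ] H)} (h : S ⊆ T) :
    (generated S).toStarSubalgebra ≤ (generated T).toStarSubalgebra :=
  generated_le (h.trans (subset_generated T))

lemma sum_sub_partialSum {n : ℕ} (x : Fin n → M.toStarSubalgebra) (k : Fin n) :
    ∑ i, x i - partialSum x k = ∑ i ∈ Finset.Ioi k, x i := by
  rw [sub_eq_iff_eq_add', partialSum, ← Finset.sum_union]
  · congr 1; ext i; simp [le_or_gt]
  · exact Finset.disjoint_left.2 fun i hi hi' =>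
      (Finset.mem_Ioi.1 hi').not_ge (Finset.mem_Iic.1 hi)

lemma commute_coe {a b : M.toStarSubalgebra} (h : Commute a b) :
    Commute (a : H →L[ℂ] H) b :=
  congrArg Subtype.val h.eq

lemma spectralProj_absVal_zero_Iic {c : ℝ} (hc : 0 < c) :
    spectralProj (absVal (0 : M.toStarSubalgebra)) (Set.Iic c) = 1 :=
  Subtype.ext (SpectralCalculus.spectralProjection_abs_zero_Iic hc)

/-- For commuting `s` and `t`, a projection `m` below `e_{(4c,∞)}(|s|)` and commuting with `t`
satisfies `τ(m e_{(-∞,c]}(|t - s|)) ≤ τ(e_{(c,∞)}(|t|) m)`. -/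
lemma IsNormalFaithfulTracialState.re_mul_spectralProj_le
    (hτ : IsNormalFaithfulTracialState M τ) {s t m : M.toStarSubalgebra} (hs : IsSelfAdjoint s)
    (ht : IsSelfAdjoint t) (hst : Commute s t) {c : ℝ} (hc : 0 < c) (hm : IsStarProjection m)
    (hqm : spectralProj (absVal s) (Set.Ioi (4 * c)) * m = m)
    (hmE : Commute m (spectralProj (absVal t) (Set.Ioi c))) :
    (τ (m * spectralProj (absVal (t - s)) (Set.Iic c))).re
      ≤ (τ (spectralProj (absVal t) (Set.Ioi c) * m)).re := by
  have hsc : IsSelfAdjoint (s : H →L[ℂ] H) := congrArg Subtype.val hs.star_eq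
  have htc : IsSelfAdjoint (t : H →L[ℂ] H) := congrArg Subtype.val ht.star_eq
  have hq := isStarProjection_spectralProj_absVal s (measurableSet_Ioi (a := 4 * c))
  have hr := isStarProjection_spectralProj_absVal (t - s) (measurableSet_Iic (a := c))
  have hE := isStarProjection_spectralProj_absVal t (measurableSet_Ioi (a := c))
  have hf : spectralProj (absVal t) (Set.Iic c) = 1 - spectralProj (absVal t) (Set.Ioi c) :=
    eq_sub_of_add_eq (Subtype.ext (SpectralCalculus.spectralProjection_abs_Iic_add_Ioi (t : H →L[ℂ] H) c))
  have h0 : spectralProj (absVal s) (Set.Ioi (4 * c)) *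
      spectralProj (absVal (t - s)) (Set.Iic c) * spectralProj (absVal t) (Set.Iic c) = 0 :=
    Subtype.ext (SpectralCalculus.spectralProjection_mul_eq_zero hsc htc (commute_coe hst) hc)
  rw [hf] at h0
  generalize spectralProj (absVal s) (Set.Ioi (4 * c)) = q at *
  generalize spectralProj (absVal (t - s)) (Set.Iic c) = r at *
  generalize spectralProj (absVal t) (Set.Ioi c) = E at *
  have hmq : m * q = m := by
    have := congrArg star hqm
    rwa [star_mul, hm.isSelfAdjoint.star_eq, hq.isSelfAdjoint.star_eq] at this
  -- From `q r (1 - E) = 0`, multiplied on the left by `m = m q`.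
  have h1 : m * r = m * r * E := by
    have h2 := congrArg (m * ·) h0
    simp only [← mul_assoc, hmq, mul_zero] at h2
    rwa [mul_sub, mul_one, sub_eq_zero] at h2
  -- `τ(m r E) = τ((E m) r)`, and `E m` is a projection because `m` and `E` commute.
  rw [h1, hτ.tracial, ← mul_assoc]
  exact hτ.re_mul_le (hE.mul hm hmE.symm) hr

/-- Induction on the number of partial sums treated. Membership in `W*(x_i : i < j)` is carried
along for independence, and commutation with `E` so that the next piece again commutes with `E`. The
lower bound is kept as `τ(E p)` rather than `τ(E)`, since only the former is additive over the
pieces. -/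
lemma exists_ottaviani_projection (hτ : IsNormalFaithfulTracialState M τ) {n : ℕ}
    {x : Fin n → M.toStarSubalgebra} (hx : ∀ i, IsSelfAdjoint (x i))
    (hind : WeaklyFullyIndependent τ x) (hcomm : ∀ k, Commute (partialSum x k) (∑ i, x i))
    {lam : ℝ} (hlam : 0 < lam) {c : ℝ}
    (hc : ∀ k, c ≤ absTail τ (∑ i, x i - partialSum x k) (Set.Iic (lam / 2)))
    (j : ℕ) (hj : j ≤ n) :
    ∃ p : M.toStarSubalgebra, IsStarProjection p ∧
      (p : H →L[ℂ] H) ∈ (generated {y | ∃ i : Fin n, (i : ℕ) < j ∧ y = x i}).toStarSubalgebra ∧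
      Commute p (spectralProj (absVal (∑ i, x i)) (Set.Ioi (lam / 2))) ∧
      (∀ k : Fin n, (k : ℕ) < j → absTail τ (partialSum x k) (Set.Ioi (2 * lam)) ≤ (τ p).re) ∧
      c * (τ p).re ≤ (τ (spectralProj (absVal (∑ i, x i)) (Set.Ioi (lam / 2)) * p)).re := by
  induction j with
  | zero =>
    exact ⟨0, .zero _, zero_mem _, Commute.zero_left _, fun k hk => absurd hk (by simp), by simp⟩
  | succ j ih =>
    obtain ⟨p, hp, hpmem, hpE, hpq, hpc⟩ := ih (by lia)
    let k : Fin n := ⟨j, hj⟩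
    have hS : IsSelfAdjoint (∑ i, x i) := isSelfAdjoint_sum _ fun i _ => hx i
    have hs : IsSelfAdjoint (partialSum x k) := isSelfAdjoint_sum _ fun i _ => hx i
    set E := spectralProj (absVal (∑ i, x i)) (Set.Ioi (lam / 2)) with hE
    have hq := isStarProjection_spectralProj_absVal (partialSum x k)
      (measurableSet_Ioi (a := 2 * lam))
    have hqE : Commute (spectralProj (absVal (partialSum x k)) (Set.Ioi (2 * lam))) E := by
      have hSc : IsSelfAdjoint ((∑ i, x i : M.toStarSubalgebra) : H →L[ℂ] H) :=
        congrArg Subtype.val hS.star_eq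
      have hsc : IsSelfAdjoint (partialSum x k : H →L[ℂ] H) := congrArg Subtype.val hs.star_eq
      have h1 := SpectralCalculus.commute_spectralProjection_abs hsc (commute_coe (hcomm k))
        (Set.Ioi (2 * lam))
      exact Subtype.ext (SpectralCalculus.commute_spectralProjection_abs hSc h1.symm _).symm.eq
    -- The new piece lies below `q_k` and is orthogonal to the old `p`.
    obtain ⟨m, hm, hqm, hpm, hmc, hmτ⟩ := hτ.exists_subprojection hq hp.one_sub
    have hpm0 : p * m = 0 := by
      rwa [sub_mul, one_mul, sub_eq_self] at hpm
    have hmE : Commute m E := Subtype.ext (hmc E (commute_coe hqE)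
      (commute_coe ((Commute.one_left E).sub_left hpE))).eq
    have hmono : {y | ∃ i : Fin n, (i : ℕ) < j ∧ y = (x i : H →L[ℂ] H)} ⊆
        {y | ∃ i : Fin n, (i : ℕ) < j + 1 ∧ y = x i} :=
      fun y ⟨i, hi, hy⟩ => ⟨i, by lia, hy⟩
    have hpmem' := generated_mono hmono hpmem
    have hmmem : (m : H →L[ℂ] H) ∈
        (generated {y | ∃ i : Fin n, (i : ℕ) < j + 1 ∧ y = x i}).toStarSubalgebra := by
      refine mem_of_commute _ fun y hy => hmc y (commute_of_mem_commutant ?_ hy)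
        ((Commute.one_left y).sub_left (commute_of_mem_commutant hpmem' hy))
      refine spectralProj_absVal_mem (coe_sum_mem _ fun i hi => ?_) _
      have : (i : ℕ) ≤ j := Fin.le_def.1 (Finset.mem_Iic.1 hi)
      exact subset_generated _ ⟨i, by lia, rfl⟩
    have hm0 := Complex.nonneg_iff.1 (hτ.nonneg_of_isStarProjection hm)
    have hind' : τ (m * spectralProj (absVal (∑ i, x i - partialSum x k)) (Set.Iic (lam / 2)))
        = τ m * τ (spectralProj (absVal (∑ i, x i - partialSum x k)) (Set.Iic (lam / 2))) := by
      -- Indices start at `0`: `m` involves `x_0, …, x_j` and `s_n - s_k` the rest, so the cut is at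
      -- `j + 1`. When `j + 1 = n` there is no cut, but `s_n - s_k = 0` and the spectral projection
      -- is `1`.
      rcases Nat.lt_or_ge (j + 1) n with hlt | hge
      · refine hind ⟨j + 1, hlt⟩ (by simp) _ _ hmmem ?_
        refine spectralProj_absVal_mem ?_ _
        rw [sum_sub_partialSum]
        exact coe_sum_mem _ fun i hi => subset_generated _
          ⟨i, Nat.succ_le_of_lt (Fin.lt_def.1 (Finset.mem_Ioi.1 hi)), rfl⟩
      · have h0 : ∑ i, x i - partialSum x k = 0 := by
          rw [sum_sub_partialSum]
          refine Finset.sum_eq_zero fun i hi => absurd (Fin.lt_def.1 (Finset.mem_Ioi.1 hi)) ?_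
          have := i.2
          simp only [k]; lia
        rw [h0, spectralProj_absVal_zero_Iic (half_pos hlam), mul_one, hτ.map_one, mul_one]
    have hmr := hτ.re_mul_spectralProj_le hs hS (hcomm k) (half_pos hlam) hm
      (by rwa [show 4 * (lam / 2) = 2 * lam by ring]) hmE
    rw [hind', Complex.mul_re, ← hm0.2, zero_mul, sub_zero] at hmr
    have hcm := mul_le_mul_of_nonneg_left (hc k) hm0.1
    rw [absTail] at hcm
    refine ⟨p + m, hp.add hm hpm0, add_mem hpmem' hmmem, hpE.add_left hmE, fun i hi => ?_, ?_⟩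
    · rw [map_add, Complex.add_re]
      rcases Nat.lt_succ_iff_lt_or_eq.1 hi with h | h
      · linarith [hpq i h, hm0.1]
      · obtain rfl : i = k := Fin.ext h
        -- `τ(m) ≥ τ(q_k) + τ(1 - p) - 1 = τ(q_k) - τ(p)`.
        rw [map_sub, hτ.map_one, Complex.sub_re, Complex.one_re] at hmτ
        rw [absTail]
        linarith
    · rw [mul_add, map_add, map_add, Complex.add_re, Complex.add_re]
      linarith

end QuantumProbability

/-! ### The inequality -/

theorem theorem2p7 {H : Type*} [NormedAddCommGroup H] [InnerProductSpace ℂ H] [CompleteSpace H]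
    (M : VonNeumannAlgebra H) (τ : M.toStarSubalgebra →ₗ[ℂ] ℂ)
    (hτ : QuantumProbability.IsNormalFaithfulTracialState M τ)
    {n : ℕ} [NeZero n] (x : Fin n → M.toStarSubalgebra)
    (hx : ∀ i, IsSelfAdjoint (x i))
    (hind : QuantumProbability.WeaklyFullyIndependent τ x)
    (hcomm : ∀ k, Commute (QuantumProbability.partialSum x k) (∑ i, x i))
    (lam : ℝ) (hlam : 0 < lam) :
    ∃ p : M.toStarSubalgebra, IsStarProjection p ∧
      Finset.univ.sup' Finset.univ_nonempty (fun k : Fin n =>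
        1 / 2 ^ (k : ℕ) *
          QuantumProbability.absTail τ (QuantumProbability.partialSum x k) (Set.Ioi (2 * lam)))
        ≤ (τ p).re ∧
      (QuantumProbability.ottavianiConst τ x lam ≠ ⊤ →
        ENNReal.ofReal (τ p).re ≤ QuantumProbability.ottavianiConst τ x lam *
          ENNReal.ofReal (QuantumProbability.absTail τ (∑ i, x i) (Set.Ioi (lam / 2)))) := by
  obtain ⟨p, hp, -, -, hpq, hpc⟩ := QuantumProbability.exists_ottaviani_projection hτ hx hind hcomm
    hlam (c := Finset.univ.inf' Finset.univ_nonempty fun k : Fin n =>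
      QuantumProbability.absTail τ (∑ i, x i - QuantumProbability.partialSum x k)
        (Set.Iic (lam / 2))) (fun k => Finset.inf'_le _ (Finset.mem_univ k)) n le_rfl
  refine ⟨p, hp, Finset.sup'_le _ _ fun k _ => ?_, fun htop => ?_⟩
  · have h0 := (Complex.nonneg_iff.1 (hτ.nonneg_of_isStarProjection
      (QuantumProbability.isStarProjection_spectralProj_absVal (QuantumProbability.partialSum x k)
        (measurableSet_Ioi (a := 2 * lam))))).1
    refine le_trans ?_ (hpq k k.2)
    -- `τ(q_k) ≤ τ(p)` already holds, so the weight `1 / 2 ^ k ≤ 1` only weakens it.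
    refine mul_le_of_le_one_left h0 ?_
    rw [div_le_one (by positivity)]
    exact one_le_pow₀ one_le_two
  · have hE := hpc.trans (hτ.re_mul_le (QuantumProbability.isStarProjection_spectralProj_absVal
      (∑ i, x i) (measurableSet_Ioi (a := lam / 2))) hp)
    rw [QuantumProbability.ottavianiConst] at htop ⊢
    -- A minimum that is not positive is truncated to `0` by `ENNReal.ofReal`, which makes the
    -- constant `⊤`.
    have hc : 0 < Finset.univ.inf' Finset.univ_nonempty fun k : Fin n =>
        QuantumProbability.absTail τ (∑ i, x i - QuantumProbability.partialSum x k)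
          (Set.Iic (lam / 2)) := by
      by_contra hneg
      exact htop (by rw [ENNReal.ofReal_of_nonpos (not_lt.1 hneg), one_div, ENNReal.inv_zero])
    rw [one_div, ← ENNReal.ofReal_inv_of_pos hc, ← ENNReal.ofReal_mul (inv_nonneg.2 hc.le)]
    refine ENNReal.ofReal_le_ofReal ?_
    rw [inv_mul_eq_div, le_div_iff₀ hc, mul_comm]
    exact hE
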